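/- A positive real algebraic integer $\lambda$ is a weak Perron number if every Galois conjugate $\lambda'\in\mathbb{C}$ of $\lambda$ satisfies $|\lambda'|\le\lambda$. For an $n\times n$ matrix $A=(a_{ij})$ put $\mathcal I_A(i)=\{1\le j\le n: a_{ij}\ne 0\}$. An irreducible $n\times n$ matrix $A$ with non-negative real entries is called admissible if: (1) (non-zero property) no row and no column of $A$ is identically zero; (2) (constant property) for each $i$, the non-zero entries of the $i$-th row of $A$ are all equal; (3) (containing property) if $\mathcal I_A(i_1)\cap\mathcal I_A(i_2)\ne\emptyset$ for some $1\le i_1<i_2\le n$, then $\mathcal I_A(i_1)\subseteq\mathcal I_A(i_2)$ or $\mathcal I_A(i_2)\subseteq\mathcal I_A(i_1)$; (4) (Markov property) for each $1\le i\le n$ there is an integer $m_i\ge 1$ such that the $i$-th row of $A^{m_i}$ contains at least two non-zero entries. The leading eigenvalue of a non-negative square matrix is its real eigenvalue $\lambda\ge 0$ such that $|\mu|\le\lambda$ for every complex eigenvalue $\mu$ of the matrix. **Proposition.** Let $\lambda>1$ be a weak Perron number. Then there exists an admissible matrix with all entries in $\{0,1\}$ whose leading eigenvalue is $\lambda$.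 -/

import Mathlib

/-- A weak Perron number: a positive real algebraic integer `lam` all of whose Galois conjugates
(the complex roots of its minimal polynomial over `ℚ`) have absolute value at most `lam`. -/
structure IsWeakPerron (lam : ℝ) : Prop where
  isIntegral : IsIntegral ℤ lam
  pos : 0 < lam
  conj_le : ∀ z ∈ (minpoly ℚ lam).aroots ℂ, ‖z‖ ≤ lam

/-- The support `I_A(i)` of the `i`-th row of `A`: the columns `j` with `A i j ≠ 0`. -/
def rowSupport {n : ℕ} (A : Matrix (Fin n) (Fin n) ℝ) (i : Fin n) : Set (Fin n) :=
  {j | A i j ≠ 0}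

/-- `A` is a `(0,1)`-matrix. -/
def IsZeroOneMatrix {n : ℕ} (A : Matrix (Fin n) (Fin n) ℝ) : Prop :=
  ∀ i j, A i j = 0 ∨ A i j = 1

/-- Admissible matrices, among matrices with non-negative entries (for which irreducibility is
strong connectedness of the associated directed graph). -/
structure IsAdmissible {n : ℕ} (A : Matrix (Fin n) (Fin n) ℝ) : Prop where
  irreducible : A.IsIrreducible
  /-- no row is identically zero -/
  row_ne_zero : ∀ i, ∃ j, A i j ≠ 0
  /-- no column is identically zero -/
  col_ne_zero : ∀ j, ∃ i, A i j ≠ 0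
  /-- the non-zero entries of each row are all equal -/
  row_const : ∀ i j k, A i j ≠ 0 → A i k ≠ 0 → A i j = A i k
  /-- row supports that meet are nested -/
  containing : ∀ i₁ i₂, i₁ < i₂ → (rowSupport A i₁ ∩ rowSupport A i₂).Nonempty →
    rowSupport A i₁ ⊆ rowSupport A i₂ ∨ rowSupport A i₂ ⊆ rowSupport A i₁
  /-- for each `i`, the `i`-th row of some positive power has at least two non-zero entries -/
  markov : ∀ i, ∃ m : ℕ, 1 ≤ m ∧ ∃ j k, j ≠ k ∧ (A ^ m) i j ≠ 0 ∧ (A ^ m) i k ≠ 0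

/-- The real number `lam` is the leading eigenvalue of `A`: it is an eigenvalue of `A`, and every
complex eigenvalue of `A` has absolute value at most `lam`. -/
def IsLeadingEigenvalue {n : ℕ} (A : Matrix (Fin n) (Fin n) ℝ) (lam : ℝ) : Prop :=
  Module.End.HasEigenvalue (Matrix.toLin' A) lam ∧
    ∀ μ : ℂ, Module.End.HasEigenvalue (Matrix.toLin' (A.map (fun x : ℝ => (x : ℂ)))) μ → ‖μ‖ ≤ lam

/-! It is enough to find a finite set `Z` of positive reals with `lam * z` a non-negative integer
combination of `Z` for every `z ∈ Z`. The multiplicities define a multigraph on `Z`. Take its edges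
as states, with a transition when the head of one is the tail of the next: entries are 0 or 1, rows
that meet coincide, and the weight of the head is a positive eigenvector for `lam`. A terminal
strong component keeps whole rows, hence the eigenvector, and is irreducible. Positivity of the
eigenvector makes `lam` leading, and `lam > 1` gives the Markov property.

To build `Z`, first pass to a power: all conjugates of maximal modulus share some power `lam ^ k`
(`IsWeakPerron.exists_pow_eq`), so `g = lam ^ k` strictly dominates its other conjugates. The
elements of `ℤ[g]` whose real value is positive, at most `R` and dominates all embeddings form a
finite set. Multiplication by `g` preserves the monoid it generates: a product that is too large
splits into nearly equal summands, and the strict gap absorbs the rounding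
(`exists_finset_of_dominant`). Multiplying by `lam ^ i` for `i < k` then descends from `lam ^ k` to
`lam`. -/

/-! ### Terminal components of finite digraphs -/

open Relation in
/-- A finite directed graph without dead ends has a terminal strongly connected component. -/
theorem exists_terminal_component {E : Type*} [Finite E] [Nonempty E] (r : E → E → Prop)
    (hr : ∀ a, ∃ b, r a b) :
    ∃ S : Set E, S.Nonempty ∧ (∀ a ∈ S, ∀ b, r a b → b ∈ S) ∧
      ∀ a b : S, TransGen (fun x y : S => r x y) a b := by
  classical
  -- Minimise the reachable set: any vertex reachable from `x` reaches a subset of it, hence all of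
  -- it.
  obtain ⟨x, hx⟩ := Finite.exists_min (fun x => {y | TransGen r x y}.ncard)
  have hclosed : ∀ a ∈ {y | TransGen r x y}, ∀ b, r a b → b ∈ {y | TransGen r x y} :=
    fun a ha b hab => TransGen.tail ha hab
  refine ⟨{y | TransGen r x y}, ?_, hclosed, ?_⟩
  · obtain ⟨y, hy⟩ := hr x
    exact ⟨y, TransGen.single hy⟩
  · rintro ⟨a, ha⟩ ⟨b, hb⟩
    have hsub : {y | TransGen r a y} ⊆ {y | TransGen r x y} := fun y hy => TransGen.trans ha hy
    have heq := Set.eq_of_subset_of_ncard_le hsub (hx a) (Set.toFinite _)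
    have hab : TransGen r a b := by
      have : b ∈ {y | TransGen r a y} := heq ▸ hb
      exact this
    clear heq hsub
    induction hab with
    | single h => exact TransGen.single h
    | tail hac hcd ih =>
      exact TransGen.tail (ih (TransGen.trans ha hac)) hcd

/-! ### Non-negative matrices with a positive eigenvector -/

namespace Matrix

theorem isIrreducible_of_transGen {n : Type*} {A : Matrix n n ℝ} (hA : ∀ i j, 0 ≤ A i j)
    (h : ∀ i j, Relation.TransGen (fun i j => 0 < A i j) i j) : A.IsIrreducible := by
  refine ⟨hA, fun i j => ?_⟩
  let := toQuiver A
  induction h i j with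
  | single h => exact ⟨Quiver.Hom.toPath ⟨h⟩, by simp⟩
  | tail _ h ih =>
    obtain ⟨p, -⟩ := ih
    exact ⟨p.cons ⟨h⟩, by simp⟩

/-- A complex eigenvalue of a non-negative matrix with a positive eigenvector is bounded by the
eigenvalue of that eigenvector. -/
theorem norm_le_of_hasEigenvalue_of_pos {n : Type*} [Fintype n] [DecidableEq n]
    {A : Matrix n n ℝ} (hA : ∀ i j, 0 ≤ A i j) {u : n → ℝ} (hu : ∀ i, 0 < u i) {r : ℝ}
    (h : A *ᵥ u = r • u) {μ : ℂ}
    (hμ : Module.End.HasEigenvalue (Matrix.toLin' (A.map (fun x : ℝ => (x : ℂ)))) μ) :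
    ‖μ‖ ≤ r := by
  obtain ⟨v, hv⟩ := hμ.exists_hasEigenvector
  have hv0 : v ≠ 0 := hv.2
  have hva : ∀ i, ∑ j, (A i j : ℂ) * v j = μ * v i := by
    intro i
    have := congrFun hv.apply_eq_smul i
    simpa [Matrix.mulVec, dotProduct] using this
  obtain ⟨k, hk⟩ := Function.ne_iff.1 hv0
  have : Nonempty n := ⟨k⟩
  -- Compare row `i` of the two eigenvector equations where `‖v i‖ / u i` is largest.
  obtain ⟨i, hi⟩ := Finite.exists_max (fun i => ‖v i‖ / u i)
  have hvi : 0 < ‖v i‖ := by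
    have h1 : 0 < ‖v k‖ / u k := div_pos (norm_pos_iff.2 hk) (hu k)
    have h2 := h1.trans_le (hi k)
    exact (div_pos_iff_of_pos_right (hu i)).1 h2
  have hui : ∑ j, A i j * u j = r * u i := by
    simpa [Matrix.mulVec, dotProduct] using congrFun h i
  have hle : ∀ j, ‖v j‖ ≤ ‖v i‖ / u i * u j := fun j => (div_le_iff₀ (hu j)).1 (hi j)
  have key : ‖μ‖ * ‖v i‖ ≤ r * ‖v i‖ := by
    calc ‖μ‖ * ‖v i‖ = ‖∑ j, (A i j : ℂ) * v j‖ := by rw [hva, norm_mul]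
      _ ≤ ∑ j, ‖(A i j : ℂ) * v j‖ := norm_sum_le _ _
      _ ≤ ∑ j, A i j * (‖v i‖ / u i * u j) := by
          refine Finset.sum_le_sum fun j _ => ?_
          rw [norm_mul, Complex.norm_real, Real.norm_of_nonneg (hA i j)]
          exact mul_le_mul_of_nonneg_left (hle j) (hA i j)
      _ = ‖v i‖ / u i * ∑ j, A i j * u j := by
          rw [Finset.mul_sum]; exact Finset.sum_congr rfl fun j _ => by ring
      _ = r * ‖v i‖ := by
          rw [hui]; have := (hu i).ne'; field_simp
  exact le_of_mul_le_mul_right key hvi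

end Matrix

/-- In a `(0,1)`-matrix with a positive eigenvector of eigenvalue greater than one, no state has
only one continuation forever. -/
theorem exists_two_ne_zero_pow_of_eigenvector {n : ℕ} {A : Matrix (Fin n) (Fin n) ℝ}
    (h01 : IsZeroOneMatrix A) {u : Fin n → ℝ} (hu : ∀ i, 0 < u i) {lam : ℝ} (hlam : 1 < lam)
    (h : A.mulVec u = lam • u) (i : Fin n) :
    ∃ m : ℕ, 1 ≤ m ∧ ∃ j k, j ≠ k ∧ (A ^ m) i j ≠ 0 ∧ (A ^ m) i k ≠ 0 := by
  by_contra! hcon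
  -- Without branching, row `i` of `A ^ m` is a unit vector at some `j` with `u j = lam ^ m * u i`,
  -- which is unbounded in `m`.
  have hrow : ∀ m : ℕ, ∃ j, lam ^ m * u i = u j ∧ ∀ k, (A ^ m) i k = if k = j then 1 else 0 := by
    intro m
    induction m with
    | zero => exact ⟨i, by simp, fun k => by simp [Matrix.one_apply, eq_comm]⟩
    | succ m ih =>
      obtain ⟨j, hj, hA⟩ := ih
      have hsucc : ∀ k, (A ^ (m + 1)) i k = A j k := by
        intro k; rw [pow_succ, Matrix.mul_apply]; simp [hA]
      have hsum : ∑ k, A j k * u k = lam * u j := by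
        simpa [Matrix.mulVec, dotProduct] using congrFun h j
      obtain ⟨k, -, hk⟩ : ∃ k ∈ Finset.univ, A j k * u k ≠ 0 := by
        apply Finset.exists_ne_zero_of_sum_ne_zero
        rw [hsum]
        exact (mul_pos (by linarith) (hu j)).ne'
      have hk0 : A j k ≠ 0 := left_ne_zero_of_mul hk
      have hk1 : A j k = 1 := (h01 j k).resolve_left hk0
      have huniq : ∀ l, l ≠ k → A j l = 0 := by
        intro l hl
        have := hcon (m + 1) (by omega) k l hl.symm (by rwa [hsucc])
        rwa [hsucc] at this
      refine ⟨k, ?_, fun l => ?_⟩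
      · rw [Finset.sum_eq_single k (fun l _ hl => by rw [huniq l hl, zero_mul]) (by simp), hk1,
          one_mul] at hsum
        rw [hsum, ← hj]; ring
      · rw [hsucc]
        split_ifs with hl
        · rw [hl, hk1]
        · exact huniq l hl
  have : Nonempty (Fin n) := ⟨i⟩
  obtain ⟨j, hj⟩ := Finite.exists_max u
  obtain ⟨m, hm⟩ := pow_unbounded_of_one_lt (u j / u i) hlam
  obtain ⟨k, hk, -⟩ := hrow m
  rw [div_lt_iff₀ (hu i), hk] at hm
  exact absurd (hj k) (not_le.2 hm)

/-! ### From integer combinations to admissible matrices -/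

/-- A finite directed graph whose out-neighbourhoods are pairwise equal or disjoint, with a positive
eigenvector of eigenvalue greater than one, contains a subgraph with admissible adjacency matrix. -/
theorem exists_admissible_of_rel {E : Type*} [Fintype E] [Nonempty E] (r : E → E → Prop)
    [DecidableRel r] {u : E → ℝ} (hu : ∀ a, 0 < u a) {lam : ℝ} (hlam : 1 < lam)
    (h : ∀ a, ∑ b, (if r a b then u b else 0) = lam * u a)
    (hr : ∀ a b c d, r a c → r b c → r a d → r b d) :
    ∃ (n : ℕ) (A : Matrix (Fin n) (Fin n) ℝ),
      IsZeroOneMatrix A ∧ IsAdmissible A ∧ IsLeadingEigenvalue A lam := by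
  classical
  have hex : ∀ a, ∃ b, r a b := by
    intro a
    obtain ⟨b, -, hb⟩ : ∃ b ∈ Finset.univ, (if r a b then u b else 0) ≠ 0 := by
      apply Finset.exists_ne_zero_of_sum_ne_zero
      rw [h]
      exact (mul_pos (by linarith) (hu a)).ne'
    exact ⟨b, by_contra fun hn => hb (if_neg hn)⟩
  obtain ⟨S, ⟨s, hs⟩, hS, hconn⟩ := exists_terminal_component r hex
  let e : Fin (Fintype.card S) ≃ S := (Fintype.equivFin S).symm
  let A : Matrix (Fin (Fintype.card S)) (Fin (Fintype.card S)) ℝ :=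
    fun i j => if r (e i) (e j) then 1 else 0
  have hA : ∀ i j, A i j = if r (e i) (e j) then 1 else 0 := fun _ _ => rfl
  have hA0 : ∀ i j, A i j ≠ 0 ↔ r (e i) (e j) := fun i j => by simp [hA]
  have h01 : IsZeroOneMatrix A := fun i j => by
    rw [hA]; split_ifs
    · exact Or.inr rfl
    · exact Or.inl rfl
  have hnn : ∀ i j, 0 ≤ A i j := fun i j => by rw [hA]; positivity
  have hpos : ∀ i j, 0 < A i j ↔ r (e i) (e j) := fun i j => by
    rw [← hA0, lt_iff_le_and_ne, ne_comm]; exact and_iff_right (hnn i j)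
  have hAu : A.mulVec (fun i => u (e i)) = lam • (fun i => u (e i)) := by
    funext i
    have h1 : ∑ j, A i j * u (e j) = ∑ b : S, if r (e i) b then u b else 0 := by
      rw [← Equiv.sum_comp e]
      exact Finset.sum_congr rfl fun j _ => by rw [hA]; split_ifs <;> simp
    -- As `S` is closed under successors, restricting to `S` loses no term of the row sum.
    have h2 : ∑ b : S, (if r (e i) b then u b else 0) = ∑ b, if r (e i) b then u b else 0 := by
      rw [← Finset.sum_subtype (Finset.univ.filter (· ∈ S)) (p := (· ∈ S)) (by simp)
        (fun b => if r (e i) b then u b else 0), Finset.sum_filter_of_ne]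
      intro b _ hb
      exact hS _ (e i).2 b (by_contra fun hn => hb (if_neg hn))
    simp only [Matrix.mulVec, dotProduct, Pi.smul_apply, smul_eq_mul]
    rw [h1, h2, h]
  have hui : ∀ i, 0 < u (e i) := fun i => hu _
  have hirr : A.IsIrreducible := by
    refine Matrix.isIrreducible_of_transGen hnn fun i j => ?_
    simp only [hpos]
    have hij := Relation.TransGen.lift (p := fun i j => r (e i) (e j)) e.symm
      (fun a b hab => by simpa [Function.onFun] using hab) _ _ (hconn (e i) (e j))
    simpa [Function.onFun] using hij
  refine ⟨_, A, h01, ⟨hirr, ?_, ?_, ?_, ?_, ?_⟩, ?_, ?_⟩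
  · intro i
    obtain ⟨b, hb⟩ := hex (e i)
    exact ⟨e.symm ⟨b, hS _ (e i).2 b hb⟩, by rw [hA0]; simpa using hb⟩
  · intro j
    obtain ⟨a, -, ha⟩ := Relation.TransGen.tail'_iff.1 (hconn (e j) (e j))
    exact ⟨e.symm a, by rw [hA0]; simpa using ha⟩
  · intro i j k hj hk
    rw [(h01 i j).resolve_left hj, (h01 i k).resolve_left hk]
  · rintro i₁ i₂ - ⟨c, hc₁, hc₂⟩
    refine Or.inl fun d hd => ?_
    simp only [rowSupport, Set.mem_ofPred_eq, hA0] at *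
    exact hr _ _ _ _ hc₁ hc₂ hd
  · exact exists_two_ne_zero_pow_of_eigenvector h01 hui hlam hAu
  · refine Module.End.hasEigenvalue_of_hasEigenvector (x := fun i => u (e i))
      (Module.End.hasEigenvector_iff.2 ⟨Module.End.mem_eigenspace_iff.2 ?_, ?_⟩)
    · rw [Matrix.toLin'_apply]; exact hAu
    · intro h0
      exact (hui (e.symm ⟨s, hs⟩)).ne' (congrFun h0 _)
  · intro μ hμ
    exact Matrix.norm_le_of_hasEigenvalue_of_pos hnn hui hAu hμ

/-- If multiplication by `lam > 1` maps a finite non-empty set of positive reals into the additive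
monoid it generates, then `lam` is the leading eigenvalue of an admissible `(0,1)`-matrix. -/
theorem exists_admissible_of_finset {lam : ℝ} (hlam : 1 < lam) (Z : Finset ℝ) (hne : Z.Nonempty)
    (hpos : ∀ z ∈ Z, 0 < z) (hZ : ∀ z ∈ Z, lam * z ∈ AddSubmonoid.closure (Z : Set ℝ)) :
    ∃ (n : ℕ) (A : Matrix (Fin n) (Fin n) ℝ),
      IsZeroOneMatrix A ∧ IsAdmissible A ∧ IsLeadingEigenvalue A lam := by
  classical
  have hM : ∀ z : Z, ∃ a : Z → ℕ, lam * (z : ℝ) = ∑ i : Z, a i • (i : ℝ) := fun z =>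
    AddSubmonoid.mem_closure_finset'.1 (hZ z z.2)
  choose M hM using hM
  -- Edges of the multigraph with `M p.1 p.2` parallel edges from `p.1` to `p.2`; using them as
  -- states removes multiplicities.
  let E := Σ p : Z × Z, Fin (M p.1 p.2)
  have hsum : ∀ z : Z, ∑ b : E, (if z = b.1.1 then (b.1.2 : ℝ) else 0) = lam * z := by
    intro z
    rw [hM, Fintype.sum_sigma, Fintype.sum_prod_type, Finset.sum_eq_single z]
    · simp
    · intro y _ hy
      simp [hy.symm]
    · simp
  have hE : Nonempty E := by
    obtain ⟨z, hz⟩ := hne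
    obtain ⟨b, -, -⟩ : ∃ b ∈ (Finset.univ : Finset E),
        (if (⟨z, hz⟩ : Z) = b.1.1 then (b.1.2 : ℝ) else 0) ≠ 0 := by
      apply Finset.exists_ne_zero_of_sum_ne_zero
      rw [hsum]
      exact (mul_pos (by linarith) (hpos z hz)).ne'
    exact ⟨b⟩
  refine exists_admissible_of_rel (E := E) (fun a b => a.1.2 = b.1.1)
    (u := fun a => (a.1.2 : ℝ)) (fun a => hpos _ a.1.2.2) hlam (fun a => hsum a.1.2) ?_
  intro a b c d hac hbc had
  exact (hbc.trans hac.symm).trans had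

/-! ### Conjugates of maximal modulus -/

open Polynomial ComplexConjugate

/-- Every conjugate of maximal modulus of a weak Perron number agrees with it after raising both to
a suitable common power. -/
theorem IsWeakPerron.exists_pow_eq {lam : ℝ} (hw : IsWeakPerron lam) :
    ∃ k : ℕ, 0 < k ∧ ∀ z ∈ (minpoly ℚ lam).aroots ℂ, ‖z‖ < lam ∨ z ^ k = (lam : ℂ) ^ k := by
  classical
  have hint : IsIntegral ℚ lam := hw.isIntegral.tower_top
  have hf0 : minpoly ℚ lam ≠ 0 := minpoly.ne_zero hint
  have hroot : ∀ z : ℂ, z ∈ (minpoly ℚ lam).aroots ℂ ↔ aeval z (minpoly ℚ lam) = 0 := fun z => by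
    rw [mem_aroots]; exact and_iff_right hf0
  let E := algebraicClosure ℚ ℂ
  have hE : ∀ z : ℂ, aeval z (minpoly ℚ lam) = 0 → z ∈ E := fun z hz =>
    mem_algebraicClosure_iff.2 ⟨_, hf0, hz⟩
  have haev : ∀ x : E, aeval x (minpoly ℚ lam) = 0 ↔ aeval (x : ℂ) (minpoly ℚ lam) = 0 := by
    intro x
    rw [← IntermediateField.coe_val, aeval_algHom_apply, IntermediateField.coe_val]
    exact (ZeroMemClass.coe_eq_zero).symm
  have hle : ∀ x : E, aeval x (minpoly ℚ lam) = 0 → ‖(x : ℂ)‖ ≤ lam := fun x hx =>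
    hw.conj_le _ ((hroot _).2 ((haev x).1 hx))
  have hlam0 : aeval (lam : ℂ) (minpoly ℚ lam) = 0 := by
    have := aeval_algebraMap_apply ℂ lam (minpoly ℚ lam)
    rw [minpoly.aeval, map_zero] at this
    exact this
  let l : E := ⟨lam, hE _ hlam0⟩
  have hl : aeval l (minpoly ℚ lam) = 0 := (haev l).2 hlam0
  let S : Finset E := ((minpoly ℚ lam).rootSet E).toFinset.filter fun x => ‖(x : ℂ)‖ = lam
  have hS : ∀ x, x ∈ S ↔ aeval x (minpoly ℚ lam) = 0 ∧ ‖(x : ℂ)‖ = lam := by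
    intro x
    simp only [S, Finset.mem_filter, Set.mem_toFinset, mem_rootSet]
    exact and_congr_left' (and_iff_right hf0)
  have hconj0 : ∀ z : ℂ, aeval z (minpoly ℚ lam) = 0 → aeval (conj z) (minpoly ℚ lam) = 0 := by
    intro z hz
    have := aeval_algHom_apply (Complex.conjAe.toAlgHom.restrictScalars ℚ) z (minpoly ℚ lam)
    rw [hz, map_zero] at this
    exact this
  have hcE : ∀ x : E, x ∈ S → conj (x : ℂ) ∈ E := fun x hx =>
    hE _ (hconj0 _ ((haev x).1 ((hS x).1 hx).1))
  have hcS : ∀ x (hx : x ∈ S), (⟨conj (x : ℂ), hcE x hx⟩ : E) ∈ S := by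
    intro x hx
    rw [hS, haev]
    refine ⟨hconj0 _ ((haev x).1 ((hS x).1 hx).1), ?_⟩
    simpa using ((hS x).1 hx).2
  -- This turns the condition of maximal modulus into an algebraic identity, which automorphisms of
  -- `E` respect.
  have hmul : ∀ x (hx : x ∈ S), x * ⟨conj (x : ℂ), hcE x hx⟩ = l ^ 2 := by
    intro x hx
    apply Subtype.ext
    change (x : ℂ) * conj (x : ℂ) = (lam : ℂ) ^ 2
    rw [Complex.mul_conj, Complex.normSq_eq_norm_sq, ((hS x).1 hx).2]
    push_cast; ring
  have hprod : (∏ x ∈ S, x) ^ 2 = l ^ (2 * S.card) := by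
    have h1 : ∏ x ∈ S.attach, (⟨conj ((x : E) : ℂ), hcE x x.2⟩ : E) = ∏ x ∈ S, x := by
      refine Finset.prod_bij (fun x _ => ⟨conj ((x : E) : ℂ), hcE x x.2⟩)
        (fun x _ => hcS x x.2) ?_ ?_ (fun _ _ => rfl)
      · intro x _ y _ hxy
        have := congrArg (fun t : E => conj (t : ℂ)) hxy
        exact Subtype.ext (Subtype.ext (by simpa using this))
      · intro y hy
        exact ⟨⟨_, hcS y hy⟩, Finset.mem_attach _ _, Subtype.ext (by simp)⟩
    calc (∏ x ∈ S, x) ^ 2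
        = (∏ x ∈ S.attach, (x : E)) * ∏ x ∈ S.attach, (⟨conj ((x : E) : ℂ), hcE x x.2⟩ : E) := by
          rw [h1, sq, Finset.prod_attach S fun x => x]
      _ = ∏ x ∈ S.attach, l ^ 2 := by
          rw [← Finset.prod_mul_distrib]
          exact Finset.prod_congr rfl fun x _ => hmul x x.2
      _ = l ^ (2 * S.card) := by rw [Finset.prod_const, Finset.card_attach, pow_mul]
  have hlS : l ∈ S := (hS l).2 ⟨hl, by
    change ‖(lam : ℂ)‖ = lam
    rw [Complex.norm_real, Real.norm_of_nonneg hw.pos.le]⟩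
  refine ⟨2 * S.card, Nat.mul_pos two_pos (Finset.card_pos.2 ⟨l, hlS⟩), fun z hz => ?_⟩
  rcases (hw.conj_le z hz).lt_or_eq with hlt | heq
  · exact Or.inl hlt
  right
  rw [hroot] at hz
  let y : E := ⟨z, hE z hz⟩
  have hclosure : IsAlgClosure ℚ E := algebraicClosure.isAlgClosure ℚ ℂ
  have hnormal : Normal ℚ E := IsAlgClosure.normal ℚ E
  obtain ⟨σ, hσ⟩ := minpoly.exists_algEquiv_of_root (x := l) (y := y)
    (Algebra.IsAlgebraic.isAlgebraic _) (by
      have : minpoly ℚ y = minpoly ℚ lam :=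
        (minpoly.eq_of_irreducible_of_monic (minpoly.irreducible hint) ((haev y).2 hz)
          (minpoly.monic hint)).symm
      rw [this]; exact hl)
  have hσ0 : ∀ x, aeval x (minpoly ℚ lam) = 0 → aeval (σ x) (minpoly ℚ lam) = 0 := by
    intro x hx
    have := aeval_algHom_apply σ.toAlgHom x (minpoly ℚ lam)
    rw [hx, map_zero] at this
    exact this
  -- `σ x` and the image of the complex conjugate of `x` have product `y ^ 2`, of modulus `lam ^ 2`,
  -- and each has modulus at most `lam`; so both attain it.
  have hσS : ∀ x ∈ S, σ x ∈ S := by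
    intro x hx
    have hx0 := ((hS x).1 hx).1
    have hc0 := ((hS _).1 (hcS x hx)).1
    refine (hS _).2 ⟨hσ0 x hx0, (hle _ (hσ0 x hx0)).antisymm ?_⟩
    have h2 : σ x * σ ⟨conj (x : ℂ), hcE x hx⟩ = y ^ 2 := by
      rw [← map_mul, hmul x hx, map_pow, hσ]
    have h3 : ‖(σ x : ℂ)‖ * ‖(σ ⟨conj (x : ℂ), hcE x hx⟩ : ℂ)‖ = lam ^ 2 := by
      have := congrArg (fun t : E => ‖(t : ℂ)‖) h2
      simp only [MulMemClass.coe_mul, SubmonoidClass.coe_pow, norm_mul, norm_pow] at this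
      rw [this]; exact congrArg (· ^ 2) heq
    have h4 := hle _ (hσ0 _ hc0)
    have h5 := mul_le_mul_of_nonneg_left h4 (norm_nonneg (σ x : ℂ))
    rw [h3, sq] at h5
    exact le_of_mul_le_mul_right h5 hw.pos
  have hσP : σ (∏ x ∈ S, x) = ∏ x ∈ S, x := by
    rw [map_prod]
    have him : S.image σ = S := Finset.eq_of_subset_of_card_le
      (Finset.image_subset_iff.2 hσS) (Finset.card_image_of_injective S σ.injective).ge
    conv_rhs => rw [← him, Finset.prod_image σ.injective.injOn]
  -- `σ` permutes `S`, so it fixes the product over `S`, whose square is `l ^ (2 * S.card)`.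
  have hy : y ^ (2 * S.card) = l ^ (2 * S.card) := by
    rw [← hprod, ← hσP, ← map_pow, hprod, map_pow, hσ]
  exact congrArg (fun t : E => (t : ℂ)) hy

/-! ### Invariant finitely generated monoids -/

/-- Division with bounded remainder by a natural number in the order `ℤ[g]`. -/
theorem exists_bounded_remainder {K : Type*} [Field K] {g : K} (hg : IsIntegral ℤ g) {B : ℝ}
    (hB : ∀ φ : K →+* ℂ, ‖φ g‖ ≤ B) {n : ℕ} (hn : 0 < n) :
    ∃ c : ℝ, ∀ x ∈ Algebra.adjoin ℤ {g}, ∃ y ∈ Algebra.adjoin ℤ {g}, ∃ t ∈ Algebra.adjoin ℤ {g},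
      x = n * y + t ∧ ∀ φ : K →+* ℂ, ‖φ t‖ ≤ c := by
  have hgm : g ∈ Algebra.adjoin ℤ {g} := Algebra.self_mem_adjoin_singleton ℤ g
  have hmem : ∀ (a : ℕ → ℤ) (s : Finset ℕ), ∑ i ∈ s, (a i : K) * g ^ i ∈ Algebra.adjoin ℤ {g} :=
    fun a s => sum_mem fun i _ => mul_mem (intCast_mem _ _) (pow_mem hgm i)
  let d := (minpoly ℤ g).natDegree + 1
  refine ⟨∑ i ∈ Finset.range d, (n : ℝ) * B ^ i, fun x hx => ?_⟩
  rw [Algebra.adjoin_singleton_eq_range_aeval] at hx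
  obtain ⟨p, rfl⟩ := hx
  -- Reduce to a representative of bounded degree and divide each coefficient by `n`; remainders in
  -- `[0, n)` bound `t` independently of `x`.
  let a := (p %ₘ minpoly ℤ g).coeff
  have hp : aeval g p = ∑ i ∈ Finset.range d, (a i : K) * g ^ i := by
    rw [← aeval_modByMonic_eq_self_of_root (minpoly.aeval ℤ g),
      (p %ₘ minpoly ℤ g).as_sum_range_C_mul_X_pow' (n := d)
        (Nat.lt_succ_of_le (natDegree_modByMonic_le _ (minpoly.monic hg))), map_sum]
    exact Finset.sum_congr rfl fun i _ => by simp [a]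
  refine ⟨_, hmem (fun i => a i / n) (Finset.range d), _, hmem (fun i => a i % n) (Finset.range d),
    ?_, fun φ => ?_⟩
  · refine hp.trans ?_
    rw [Finset.mul_sum, ← Finset.sum_add_distrib]
    refine Finset.sum_congr rfl fun i _ => ?_
    have h : ((n : ℤ) * (a i / n) + a i % n : ℤ) = a i := Int.mul_ediv_add_emod _ _
    have h' := congrArg (Int.cast : ℤ → K) h
    push_cast at h'
    rw [← mul_assoc, ← add_mul, h']
  · rw [map_sum]
    refine (norm_sum_le _ _).trans (Finset.sum_le_sum fun i _ => ?_)
    rw [map_mul, map_intCast, map_pow, norm_mul, norm_pow]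
    refine mul_le_mul ?_ (pow_le_pow_left₀ (norm_nonneg _) (hB φ) i) (by positivity) (by positivity)
    rw [Complex.norm_intCast]
    have h0 : 0 ≤ a i % n := Int.emod_nonneg _ (by exact_mod_cast hn.ne')
    have h1 : a i % n ≤ n := (Int.emod_lt_of_pos _ (by exact_mod_cast hn)).le
    rw [abs_of_nonneg (by exact_mod_cast h0)]
    exact_mod_cast h1

/-- If an algebraic integer `g` dominates all its conjugates under a real embedding `ι`, then
multiplication by `ι g` preserves a finitely generated monoid of positive reals. -/
theorem exists_finset_of_dominant {K : Type*} [Field K] [NumberField K] (ι : K →+* ℝ) {g : K}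
    (hg : IsIntegral ℤ g) (hL : 1 < ι g)
    (hdom : ∀ φ : K →+* ℂ, ‖φ g‖ < ι g ∨ φ g = (ι g : ℂ)) :
    ∃ Z : Finset ℝ, Z.Nonempty ∧ (∀ z ∈ Z, 0 < z) ∧
      ∀ z ∈ Z, ι g * z ∈ AddSubmonoid.closure (Z : Set ℝ) := by
  classical
  set L := ι g with hLdef
  have hB : ∀ φ : K →+* ℂ, ‖φ g‖ ≤ L := fun φ => by
    rcases hdom φ with h | h
    · exact h.le
    · rw [h, Complex.norm_real, Real.norm_of_nonneg (by linarith)]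
  -- There are finitely many embeddings, so the gap `L - ρ` is uniform.
  obtain ⟨ρ, hρL, hρ⟩ : ∃ ρ < L, ∀ φ : K →+* ℂ, ‖φ g‖ ≤ ρ ∨ φ g = (L : ℂ) := by
    let F : Finset (K →+* ℂ) := Finset.univ.filter fun φ => ‖φ g‖ < L
    rcases F.eq_empty_or_nonempty with hF | hF
    · refine ⟨0, by linarith, fun φ => Or.inr ((hdom φ).resolve_left fun h => ?_)⟩
      have : φ ∈ F := by simpa [F] using h
      simp [hF] at this
    · obtain ⟨ψ, hψ, hmax⟩ := F.exists_max_image (fun φ => ‖φ g‖) hF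
      refine ⟨‖ψ g‖, (Finset.mem_filter.1 hψ).2, fun φ => ?_⟩
      rcases hdom φ with h | h
      · exact Or.inl (hmax φ (by simpa [F] using h))
      · exact Or.inr h
  obtain ⟨n, hn⟩ := exists_nat_ge (2 * L)
  have hn0 : (0 : ℝ) < n := by linarith
  have hn1 : 0 < n := by exact_mod_cast hn0
  obtain ⟨c, hc⟩ := exists_bounded_remainder hg hB hn1
  have hgm : g ∈ Algebra.adjoin ℤ {g} := Algebra.self_mem_adjoin_singleton ℤ g
  have hι : ∀ x, ‖(Complex.ofRealHom.comp ι) x‖ = |ι x| := fun x => Complex.norm_real _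
  -- `g` need not generate `K`, so several embeddings may send it to `L`; they all agree with `ι` on
  -- `ℤ[g]`.
  have heq : ∀ φ : K →+* ℂ, φ g = (L : ℂ) → ∀ x ∈ Algebra.adjoin ℤ {g}, φ x = (ι x : ℂ) := by
    intro φ hφ x hx
    induction hx using Algebra.adjoin_induction with
    | mem x hx => rw [Set.mem_singleton_iff.1 hx, hφ]
    | algebraMap r => simp
    | add x y _ _ hx hy => rw [map_add, map_add, hx, hy, Complex.ofReal_add]
    | mul x y _ _ hx hy => rw [map_mul, map_mul, hx, hy, Complex.ofReal_mul]
  have hc0 : 0 ≤ c := by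
    obtain ⟨_, _, t, _, _, ht⟩ := hc 0 (zero_mem _)
    exact (norm_nonneg _).trans (ht (Complex.ofRealHom.comp ι))
  -- In order, the bounds put `1` in `W`, keep `y` and `y + t` below `R`, make `ι y > c` so that `y
  -- + t` is positive, and let the gap pay for the errors `t` in the domination conditions.
  obtain ⟨R, hR⟩ : ∃ R : ℝ, 1 ≤ R ∧ 4 * c ≤ R ∧ c + n * c < R ∧
      (2 * c + 2 * n * c) * L ≤ (L - ρ) * R := by
    have hLρ : 0 < L - ρ := by linarith
    obtain ⟨R, hR⟩ := exists_gt (max (max 1 (4 * c))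
      (max (c + n * c) ((2 * c + 2 * n * c) * L / (L - ρ))))
    simp only [max_lt_iff] at hR
    refine ⟨R, hR.1.1.le, hR.1.2.le, hR.2.1, ?_⟩
    have := (div_lt_iff₀ hLρ).1 hR.2.2
    linarith
  obtain ⟨hR1, hR4, hRc, hRL⟩ := hR
  let W : Set K := {x | x ∈ Algebra.adjoin ℤ {g} ∧ 0 < ι x ∧ ι x ≤ R ∧ ∀ φ : K →+* ℂ, ‖φ x‖ ≤ ι x}
  have hW : W.Finite := by
    refine (NumberField.Embeddings.finite_of_norm_le K ℂ R).subset fun x hx => ⟨?_, fun φ => ?_⟩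
    · exact (adjoin_le_integralClosure hg) hx.1
    · exact (hx.2.2.2 φ).trans hx.2.2.1
  have hmemW : ∀ x ∈ Algebra.adjoin ℤ {g}, 0 < ι x → ι x ≤ R →
      (∀ φ : K →+* ℂ, ‖φ g‖ ≤ ρ → ‖φ x‖ ≤ ι x) → x ∈ W := by
    refine fun x hx h0 h1 h2 => ⟨hx, h0, h1, fun φ => ?_⟩
    rcases hρ φ with h | h
    · exact h2 φ h
    · rw [heq φ h x hx, Complex.norm_real, Real.norm_of_nonneg h0.le]
  refine ⟨hW.toFinset.image ι, ?_, ?_, ?_⟩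
  · refine ⟨ι 1, Finset.mem_image_of_mem _ (hW.mem_toFinset.2 ⟨one_mem _, ?_, ?_, fun φ => ?_⟩)⟩
    · simp
    · simpa using hR1
    · simp
  · intro z hz
    obtain ⟨x, hx, rfl⟩ := Finset.mem_image.1 hz
    exact (hW.mem_toFinset.1 hx).2.1
  intro z hz
  obtain ⟨x, hx, rfl⟩ := Finset.mem_image.1 hz
  obtain ⟨hxm, hx0, hxR, hxφ⟩ := hW.mem_toFinset.1 hx
  have hcl : ∀ y ∈ W, ι y ∈ AddSubmonoid.closure ((hW.toFinset.image ι : Finset ℝ) : Set ℝ) :=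
    fun y hy => AddSubmonoid.subset_closure
      (Finset.mem_coe.2 (Finset.mem_image_of_mem _ (hW.mem_toFinset.2 hy)))
  rw [hLdef, ← map_mul]
  have hιgx : ι (g * x) = L * ι x := map_mul _ _ _
  have hφgx : ∀ φ : K →+* ℂ, ‖φ g‖ ≤ ρ → ‖φ (g * x)‖ ≤ ρ * ι x := fun φ h => by
    rw [map_mul, norm_mul]
    exact mul_le_mul h (hxφ φ) (norm_nonneg _) ((norm_nonneg _).trans h)
  by_cases hbig : L * ι x ≤ R
  · refine hcl _ (hmemW _ (mul_mem hgm hxm) ?_ ?_ fun φ h => (hφgx φ h).trans ?_)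
    · rw [hιgx]; positivity
    · rwa [hιgx]
    · rw [hιgx]; exact mul_le_mul_of_nonneg_right hρL.le hx0.le
  push Not at hbig
  -- The product is too large for `W`, so it is split as `g * x = (n - 1) * y + (y + t)`. The choice
  -- `n ≥ 2 * L` gives `ι y ≤ R / 2 + c`.
  obtain ⟨y, hy, t, ht, hxyt, htφ⟩ := hc (g * x) (mul_mem hgm hxm)
  have hιt : |ι t| ≤ c := by rw [← hι]; exact htφ _
  obtain ⟨ht1, ht2⟩ := abs_le.1 hιt
  have hιy : (n : ℝ) * ι y + ι t = L * ι x := by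
    rw [← hιgx, hxyt, map_add, map_mul, map_natCast]
  have hn1' : (1 : ℝ) ≤ n := by exact_mod_cast hn1
  have hnc : c ≤ n * c := le_mul_of_one_le_left hc0 hn1'
  have hgap : 2 * c + 2 * n * c ≤ (L - ρ) * ι x := by
    have h1 : (L - ρ) * R ≤ (L - ρ) * (L * ι x) :=
      mul_le_mul_of_nonneg_left hbig.le (by linarith)
    have h2 : (2 * c + 2 * n * c) * L ≤ ((L - ρ) * ι x) * L := by linarith
    exact le_of_mul_le_mul_right h2 (by linarith)
  have hyφ : ∀ φ : K →+* ℂ, ‖φ g‖ ≤ ρ → n * ‖φ y‖ ≤ ρ * ι x + c := fun φ h => by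
    have h1 : (n : ℂ) * φ y = φ (g * x) - φ t := by
      rw [hxyt, map_add, map_mul, map_natCast]; ring
    have h2 := congrArg norm h1
    rw [norm_mul, Complex.norm_natCast] at h2
    rw [h2]
    exact (norm_sub_le _ _).trans (add_le_add (hφgx φ h) (htφ φ))
  have hyc : n * c < n * ι y := by linarith
  have hyc' : c < ι y := lt_of_mul_lt_mul_left hyc hn0.le
  have hyR : ι y ≤ R / 2 + c := by
    have h1 : L * ι x ≤ L * R := mul_le_mul_of_nonneg_left hxR (by linarith)
    have h2 : 2 * L * R ≤ n * R := mul_le_mul_of_nonneg_right hn (by linarith)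
    have h3 : n * ι y ≤ n * (R / 2 + c) := by linarith
    exact le_of_mul_le_mul_left h3 hn0
  have hyW : y ∈ W := hmemW y hy (by linarith) (by linarith) fun φ h => by
    have h1 : n * ‖φ y‖ ≤ n * ι y := by linarith [hyφ φ h]
    exact le_of_mul_le_mul_left h1 hn0
  have hytW : y + t ∈ W := by
    refine hmemW _ (add_mem hy ht) ?_ ?_ fun φ h => ?_
    · rw [map_add]; linarith
    · rw [map_add]; linarith
    · rw [map_add, map_add]
      have h1 : n * (‖φ y‖ + c) ≤ n * (ι y - c) := by linarith [hyφ φ h]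
      have h2 := le_of_mul_le_mul_left h1 hn0
      linarith [norm_add_le (φ y) (φ t), htφ φ]
  have hsplit : ι (g * x) = (n - 1) • ι y + ι (y + t) := by
    rw [hιgx, ← hιy, map_add, nsmul_eq_mul, Nat.cast_sub hn1]; push_cast; ring
  rw [hsplit]
  exact add_mem (nsmul_mem (hcl y hyW) _) (hcl _ hytW)

/-- From a finitely generated monoid of positive reals preserved by `lam ^ k` one obtains one
preserved by `lam`. -/
theorem exists_finset_of_pow {lam : ℝ} (hlam : 0 < lam) {k : ℕ} (hk : 0 < k) {Z : Finset ℝ}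
    (hne : Z.Nonempty) (hpos : ∀ z ∈ Z, 0 < z)
    (hZ : ∀ z ∈ Z, lam ^ k * z ∈ AddSubmonoid.closure (Z : Set ℝ)) :
    ∃ Z' : Finset ℝ, Z'.Nonempty ∧ (∀ z ∈ Z', 0 < z) ∧
      ∀ z ∈ Z', lam * z ∈ AddSubmonoid.closure (Z' : Set ℝ) := by
  classical
  -- Multiplication by `lam` raises the exponent `i`; from `i = k - 1` it lands on `lam ^ k * z`,
  -- covered by `hZ`.
  let Z' := (Finset.range k ×ˢ Z).image fun p => lam ^ p.1 * p.2
  have hmem : ∀ i < k, ∀ z ∈ Z, lam ^ i * z ∈ Z' := fun i hi z hz =>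
    Finset.mem_image.2 ⟨(i, z), Finset.mem_product.2 ⟨Finset.mem_range.2 hi, hz⟩, rfl⟩
  have hsub : (Z : Set ℝ) ⊆ Z' := fun z hz => by simpa using hmem 0 hk z hz
  refine ⟨Z', hne.elim fun z hz => ⟨_, hmem 0 hk z hz⟩, fun w hw => ?_, fun w hw => ?_⟩
  all_goals
    obtain ⟨⟨i, z⟩, hiz, rfl⟩ := Finset.mem_image.1 hw
    obtain ⟨hi, hz⟩ := Finset.mem_product.1 hiz
  · exact mul_pos (pow_pos hlam _) (hpos z hz)
  · have hi' : i + 1 ≤ k := Finset.mem_range.1 hi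
    rw [← mul_assoc, ← pow_succ']
    rcases hi'.lt_or_eq with h | h
    · exact AddSubmonoid.subset_closure (hmem _ h z hz)
    · rw [h]
      exact AddSubmonoid.closure_mono hsub (hZ z hz)

/-! ### Assembly in the number field generated by `lam` -/

open IntermediateField in
theorem mainTheorem4 (lam : ℝ) (hlam : 1 < lam) (hw : IsWeakPerron lam) :
    ∃ (n : ℕ) (A : Matrix (Fin n) (Fin n) ℝ),
      IsZeroOneMatrix A ∧ IsAdmissible A ∧ IsLeadingEigenvalue A lam := by
  obtain ⟨k, hk, hconj⟩ := hw.exists_pow_eq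
  have hint : IsIntegral ℚ lam := hw.isIntegral.tower_top
  have hfin : FiniteDimensional ℚ ℚ⟮lam⟯ := adjoin.finiteDimensional hint
  have hnf : NumberField ℚ⟮lam⟯ := { to_charZero := inferInstance, to_finiteDimensional := hfin }
  let γ : ℚ⟮lam⟯ := AdjoinSimple.gen ℚ lam
  let ι : ℚ⟮lam⟯ →+* ℝ := algebraMap ℚ⟮lam⟯ ℝ
  have hγ : ι γ = lam := AdjoinSimple.algebraMap_gen ℚ lam
  have hιg : ι (γ ^ k) = lam ^ k := by rw [map_pow, hγ]
  have hγint : IsIntegral ℤ γ := by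
    rw [← isIntegral_algebraMap_iff (algebraMap ℚ⟮lam⟯ ℝ).injective]
    change IsIntegral ℤ (ι γ)
    rw [hγ]
    exact hw.isIntegral
  have hdom : ∀ φ : ℚ⟮lam⟯ →+* ℂ, ‖φ (γ ^ k)‖ < ι (γ ^ k) ∨ φ (γ ^ k) = (ι (γ ^ k) : ℂ) := by
    intro φ
    have hroot : φ γ ∈ (minpoly ℚ lam).aroots ℂ := by
      rw [mem_aroots]
      refine ⟨minpoly.ne_zero hint, ?_⟩
      have h0 : aeval γ (minpoly ℚ lam) = 0 := by
        rw [← minpoly_gen ℚ lam]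
        exact minpoly.aeval ℚ γ
      rw [← RingHom.toRatAlgHom_apply φ, aeval_algHom_apply, h0, map_zero]
    rw [hιg, map_pow, norm_pow]
    rcases hconj _ hroot with h | h
    · exact Or.inl (pow_lt_pow_left₀ h (norm_nonneg _) hk.ne')
    · right; rw [h]; push_cast; rfl
  obtain ⟨Z, hne, hpos, hZ⟩ := exists_finset_of_dominant ι (hγint.pow k)
    (by rw [hιg]; exact one_lt_pow₀ hlam hk.ne') hdom
  rw [hιg] at hZ
  obtain ⟨Z', hne', hpos', hZ'⟩ := exists_finset_of_pow hw.pos hk hne hpos hZ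
  exact exists_admissible_of_finset hlam Z' hne' hpos' hZ'
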